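/- Let $\Omega\subsetneq\mathbb C$ be a Jordan domain, i.e. a bounded simply connected domain whose boundary is a Jordan curve. Let $(\varphi_t)_{t\ge0}$ be a semiflow of holomorphic self-maps of $\Omega$, i.e. $\varphi_0=\mathrm{id}$, $\varphi_{s+t}=\varphi_s\circ\varphi_t$, and $\varphi_t(z)\to z$ as $t\to0^+$ for all $z\in\Omega$. Let $G(z)=\lim_{t\to0^+}(\varphi_t(z)-z)/t$ $(z\in\Omega)$ be its generator. Let $g:\Omega\to\mathbb C$ be holomorphic and put $m_t(z)=\exp\big(\int_0^t g(\varphi_s(z))\,ds\big)$. Let $X$ be a Banach space of holomorphic functions on $\Omega$ with continuous point evaluations, and suppose that $X$ is $(g,G)$-admissible: for every $f\in X$ and $t\ge0$ the function $S_tf:=m_t\cdot(f\circ\varphi_t)$ belongs to $X$, and $S_tf\to f$ in $X$ as $t\to0^+$. Let $k:\Omega\to\mathbb D$ be a conformal map, extended continuously to $\partial\Omega$, and write $f_r(x)=f(k^{-1}(rk(x)))$. Suppose that $X$ has a boundary space $\partial X$: every $f\in X$ has a boundary distribution $f^*=\operatorname{Tr}f$ on $\partial\Omega$, given by $$\langle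 f^*,\phi\rangle=\lim_{r\to1^-}\int_{\partial\Omega}f_r\,\phi\,dx\qquad(\phi\in C^\infty(\partial\Omega)),$$ where $dx$ is arc length, the integrals exist for $r$ near $1$, and $C^\infty(\partial\Omega)$ consists of the restrictions to $\partial\Omega$ of smooth functions on the plane; and $f\mapsto f^*$ is injective on $X$. Let $\partial X=\{f^*:f\in X\}$, normed by $\|f^*\|_{\partial X}=\|f\|_X$. The Dirichlet-to-Robin operator $\mathfrak D_{\mathcal R}$ in $\partial X$ maps $v$ to $\operatorname{Tr}(g\cdot u+G\cdot\partial_zu)$, where $u\in X$ is the harmonic (indeed holomorphic) function on $\Omega$ with $\operatorname{Tr}u=v$; its domain consists of those $v$ for which $g\cdot u+G\cdot\partial_zu\in X$. Consider the evolution problem $$\begin{cases}\partial_tu-g\cdot u-G\cdot\partial_zu=0&\text{on }(0,\infty)\times\partial\Omega,\\ -\Delta u=0&\text{on }(0,\infty)\times\Omega,\\ u(0,\cdot)=u_0&\text{on }\partial\Omega,\end{cases}$$ that is, $v'(t)=\mathfrak D_{\mathcal R}v(t)$ for $t>0$ and $v(0)=u_0$, where $v(t)=\operatorname{Tr}u(t,\cdot)$.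 A solution is a continuous function $v:[0,\infty)\to\partial X$ satisfying these equations, with $v'(t)$ the derivative in $\partial X$. It is called classical if in addition it is continuously differentiable on $[0,\infty)$ and satisfies the equation at $t=0$ as well. Then the evolution problem is well-posed in $\partial X$: the domain of $\mathfrak D_{\mathcal R}$ is dense in $\partial X$; for every $u_0$ in this domain there is a classical solution; for every $u_0\in\partial X$ there is at most one solution; and for every $\tau\ge0$ there is a constant $C$ such that every solution satisfies $\|v(t)\|\le C\|u_0\|$ for $0\le t\le\tau$. Moreover, the solution is the trace of the weighted composition semigroup: the formula $$T_t(\operatorname{Tr}u)=\operatorname{Tr}\big(m_t\cdot(u\circ\varphi_t)\big)\qquad(u\in X,\ t\ge0)$$ defines a strongly continuous semigroup $(T_t)_{t\ge0}$ of bounded operators on $\partial X$, whose generator is exactly $\mathfrak D_{\mathcal R}$ with the domain above. For $u_0$ in this domain, $t\mapsto T_tu_0$ is the classical solution. For every $u_0\in\partial X$, $t\mapsto T_tu_0$ is the unique mild solution, i.e. the unique continuous $v:[0,\infty)\to\partial X$ such that for all $t\ge0$ the integral $\int_0^tv(s)\,ds$ lies in the domain of $\mathfrak D_{\mathcal R}$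 and $v(t)=u_0+\mathfrak D_{\mathcal R}\int_0^tv(s)\,ds$. -/

import Mathlib

open Set Filter Topology MeasureTheory
open scoped ContDiff

noncomputable section

namespace DirichletRobin

/-! ### Jordan domains and holomorphic semiflows -/

/-- A Jordan domain: a bounded simply connected open subset of the plane whose boundary is a
Jordan curve. -/
structure IsJordanDomain (Ω : Set ℂ) : Prop where
  isOpen : IsOpen Ω
  simplyConnected : SimplyConnectedSpace Ω
  isBounded : Bornology.IsBounded Ω
  boundary : ∃ γ : Circle → ℂ, Continuous γ ∧ Function.Injective γ ∧ range γ = frontier Ω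

/-- `k` restricts to a conformal map (a holomorphic bijection) of `Ω` onto the unit disc. -/
structure IsConformalToDisc (Ω : Set ℂ) (k : ℂ → ℂ) : Prop where
  holomorphic : DifferentiableOn ℂ k Ω
  bijOn : BijOn k Ω (Metric.ball 0 1)

/-- A semiflow of holomorphic self-maps of `Ω`; only times `t ≥ 0` and points of `Ω` matter. -/
structure IsHolomorphicSemiflow (Ω : Set ℂ) (φ : ℝ → ℂ → ℂ) : Prop where
  holomorphic : ∀ t, 0 ≤ t → DifferentiableOn ℂ (φ t) Ω
  mapsTo : ∀ t, 0 ≤ t → MapsTo (φ t) Ω Ω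
  map_zero : ∀ z ∈ Ω, φ 0 z = z
  map_add : ∀ s t, 0 ≤ s → 0 ≤ t → ∀ z ∈ Ω, φ (s + t) z = φ s (φ t z)
  tendsto_zero : ∀ z ∈ Ω, Tendsto (fun t => φ t z) (𝓝[>] 0) (𝓝 z)

/-- `G` is the generator of the semiflow `φ` on `Ω`: `G(z) = lim_{t → 0+} (φ_t(z) - z) / t`. -/
def IsSemiflowGenerator (Ω : Set ℂ) (φ : ℝ → ℂ → ℂ) (G : ℂ → ℂ) : Prop :=
  ∀ z ∈ Ω, Tendsto (fun t : ℝ => (φ t z - z) / (t : ℂ)) (𝓝[>] 0) (𝓝 (G z))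

/-- The cocycle `m_t(z) = exp (∫_0^t g(φ_s(z)) ds)`. -/
def cocycle (φ : ℝ → ℂ → ℂ) (g : ℂ → ℂ) (t : ℝ) (z : ℂ) : ℂ :=
  Complex.exp (∫ s in (0 : ℝ)..t, g (φ s z))

/-- The weighted composition operator `f ↦ m_t · (f ∘ φ_t)`. -/
def weightedComp (φ : ℝ → ℂ → ℂ) (g : ℂ → ℂ) (t : ℝ) (f : ℂ → ℂ) (z : ℂ) : ℂ :=
  cocycle φ g t z * f (φ t z)

/-! ### Banach spaces of holomorphic functions, admissibility -/

section Spaces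

variable {X : Type*} [NormedAddCommGroup X] [NormedSpace ℂ X]

/-- The linear map `ι` realises `X` as a space of holomorphic functions on `Ω` (functions are
identified when they agree on `Ω`), with continuous point evaluations. -/
structure IsHolomorphicFunctionSpace (Ω : Set ℂ) (ι : X →ₗ[ℂ] (ℂ → ℂ)) : Prop where
  holomorphic : ∀ f : X, DifferentiableOn ℂ (ι f) Ω
  injective : ∀ f f' : X, EqOn (ι f) (ι f') Ω → f = f'
  continuous_eval : ∀ z ∈ Ω, Continuous fun f : X => ι f z

/-- `(g, G)`-admissibility, where `G` is the generator of `φ`: the operators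
`S_t f = m_t · (f ∘ φ_t)` leave `X` invariant, and `S_t f → f` in `X` as `t → 0+`. -/
def IsAdmissible (Ω : Set ℂ) (φ : ℝ → ℂ → ℂ) (g : ℂ → ℂ) (ι : X →ₗ[ℂ] (ℂ → ℂ)) : Prop :=
  ∃ S : ℝ → X → X,
    (∀ t, 0 ≤ t → ∀ f : X, EqOn (ι (S t f)) (weightedComp φ g t (ι f)) Ω) ∧
    ∀ f : X, Tendsto (fun t => S t f) (𝓝[>] 0) (𝓝 f)

/-! ### Distributions on the boundary -/

/-- Test functions on `∂Ω`: restrictions to `∂Ω` of smooth functions on the plane. -/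
def BoundaryTest (Ω : Set ℂ) : Submodule ℂ (frontier Ω → ℂ) where
  carrier := {ϕ | ∃ Φ : ℂ → ℂ, ContDiff ℝ ∞ Φ ∧ ∀ x : frontier Ω, ϕ x = Φ x}
  add_mem' := by
    rintro a b ⟨A, hA, hA'⟩ ⟨B, hB, hB'⟩
    exact ⟨fun z => A z + B z, hA.add hB, fun x => by simp [hA', hB']⟩
  zero_mem' := ⟨fun _ => 0, contDiff_const, fun _ => rfl⟩
  smul_mem' := by
    rintro c a ⟨A, hA, hA'⟩
    exact ⟨fun z => c * A z, contDiff_const.mul hA, fun x => by simp [hA']⟩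

/-- Distributions on `∂Ω`: linear functionals on the test functions which are continuous, that is,
bounded by finitely many derivatives, on some disc, of any smooth extension `Φ` of the test
function. -/
def BoundaryDistribution (Ω : Set ℂ) : Submodule ℂ (BoundaryTest Ω →ₗ[ℂ] ℂ) where
  carrier := {T | ∃ (C : ℝ) (N : ℕ) (R : ℝ), ∀ (ϕ : BoundaryTest Ω) (Φ : ℂ → ℂ) (M : ℝ),
    ContDiff ℝ ∞ Φ → (∀ x : frontier Ω, (ϕ : frontier Ω → ℂ) x = Φ x) →
    (∀ j ≤ N, ∀ z : ℂ, ‖z‖ ≤ R → ‖iteratedFDeriv ℝ j Φ z‖ ≤ M) → ‖T ϕ‖ ≤ C * M}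
  add_mem' := by
    rintro S T ⟨C, N, R, h⟩ ⟨C', N', R', h'⟩
    refine ⟨C + C', max N N', max R R', fun ϕ Φ M hΦ hϕ hM => ?_⟩
    have h1 := h ϕ Φ M hΦ hϕ fun j hj z hz =>
      hM j (hj.trans (le_max_left _ _)) z (hz.trans (le_max_left _ _))
    have h2 := h' ϕ Φ M hΦ hϕ fun j hj z hz =>
      hM j (hj.trans (le_max_right _ _)) z (hz.trans (le_max_right _ _))
    calc ‖(S + T) ϕ‖ ≤ ‖S ϕ‖ + ‖T ϕ‖ := norm_add_le _ _
      _ ≤ (C + C') * M := by linarith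
  zero_mem' := ⟨0, 0, 0, fun _ _ _ _ _ _ => by simp⟩
  smul_mem' := by
    rintro c T ⟨C, N, R, h⟩
    refine ⟨‖c‖ * C, N, R, fun ϕ Φ M hΦ hϕ hM => ?_⟩
    have h1 := h ϕ Φ M hΦ hϕ hM
    calc ‖(c • T) ϕ‖ = ‖c‖ * ‖T ϕ‖ := by simp
      _ ≤ ‖c‖ * C * M := by
        rw [mul_assoc]
        exact mul_le_mul_of_nonneg_left h1 (norm_nonneg c)

/-- `f_r(x) = f (k⁻¹ (r k(x)))` for `x ∈ ∂Ω`, where `k` on `∂Ω` is its continuous extension. -/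
def dilate (Ω : Set ℂ) (k f : ℂ → ℂ) (r : ℝ) (x : ℂ) : ℂ :=
  f (Function.invFunOn k Ω ((r : ℂ) * extendFrom Ω k x))

/-- `T` is the boundary distribution of `f`:
`⟨T, ϕ⟩ = lim_{r → 1-} ∫_{∂Ω} f_r(x) ϕ(x) dx` for all test functions `ϕ`, where `dx` is arc length,
that is, one-dimensional Hausdorff measure on `∂Ω`. -/
def IsBoundaryValue (Ω : Set ℂ) (k f : ℂ → ℂ) (T : BoundaryDistribution Ω) : Prop :=
  ∀ ϕ : BoundaryTest Ω,
    (∀ᶠ r : ℝ in 𝓝[<] 1, Integrable (fun x : frontier Ω =>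
      dilate Ω k f r x * (ϕ : frontier Ω → ℂ) x) (Measure.hausdorffMeasure 1)) ∧
    Tendsto (fun r : ℝ => ∫ x : frontier Ω,
      dilate Ω k f r x * (ϕ : frontier Ω → ℂ) x ∂(Measure.hausdorffMeasure 1))
      (𝓝[<] 1) (𝓝 ((T : BoundaryTest Ω →ₗ[ℂ] ℂ) ϕ))

theorem IsBoundaryValue.unique {Ω : Set ℂ} {k f : ℂ → ℂ} {S T : BoundaryDistribution Ω}
    (hS : IsBoundaryValue Ω k f S) (hT : IsBoundaryValue Ω k f T) : S = T := by
  apply Subtype.ext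
  ext ϕ
  exact tendsto_nhds_unique (hS ϕ).2 (hT ϕ).2

theorem IsBoundaryValue.zero (Ω : Set ℂ) (k : ℂ → ℂ) : IsBoundaryValue Ω k 0 0 := by
  intro ϕ
  simp [dilate]

theorem IsBoundaryValue.add {Ω : Set ℂ} {k f f' : ℂ → ℂ} {S T : BoundaryDistribution Ω}
    (hS : IsBoundaryValue Ω k f S) (hT : IsBoundaryValue Ω k f' T) :
    IsBoundaryValue Ω k (f + f') (S + T) := by
  intro ϕ
  have key : ∀ (r : ℝ) (x : frontier Ω), dilate Ω k (f + f') r x * (ϕ : frontier Ω → ℂ) x =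
      dilate Ω k f r x * (ϕ : frontier Ω → ℂ) x + dilate Ω k f' r x * (ϕ : frontier Ω → ℂ) x :=
    fun r x => by simp [dilate, add_mul]
  simp only [key]
  constructor
  · filter_upwards [(hS ϕ).1, (hT ϕ).1] with r h1 h2 using h1.add h2
  · refine ((hS ϕ).2.add (hT ϕ).2).congr' ?_
    filter_upwards [(hS ϕ).1, (hT ϕ).1] with r h1 h2 using (integral_add h1 h2).symm

theorem IsBoundaryValue.smul {Ω : Set ℂ} {k f : ℂ → ℂ} {S : BoundaryDistribution Ω} (c : ℂ)
    (hS : IsBoundaryValue Ω k f S) : IsBoundaryValue Ω k (c • f) (c • S) := by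
  intro ϕ
  have key : ∀ (r : ℝ) (x : frontier Ω), dilate Ω k (c • f) r x * (ϕ : frontier Ω → ℂ) x =
      c * (dilate Ω k f r x * (ϕ : frontier Ω → ℂ) x) :=
    fun r x => by simp [dilate, mul_assoc]
  simp only [key]
  constructor
  · filter_upwards [(hS ϕ).1] with r h1 using h1.const_mul c
  · refine ((hS ϕ).2.const_mul c).congr fun r => ?_
    exact (integral_const_mul c _).symm

/-! ### The boundary space `∂X` -/

/-- The set of all boundary distributions of elements of `X`. -/
def boundaryValues (Ω : Set ℂ) (k : ℂ → ℂ) (ι : X →ₗ[ℂ] (ℂ → ℂ)) :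
    Submodule ℂ (BoundaryDistribution Ω) where
  carrier := {T | ∃ f : X, IsBoundaryValue Ω k (ι f) T}
  add_mem' := by
    rintro S T ⟨f, hf⟩ ⟨f', hf'⟩
    exact ⟨f + f', by rw [map_add]; exact hf.add hf'⟩
  zero_mem' := ⟨0, by rw [map_zero]; exact IsBoundaryValue.zero Ω k⟩
  smul_mem' := by
    rintro c T ⟨f, hf⟩
    exact ⟨c • f, by rw [map_smul]; exact hf.smul c⟩

/-- `X` has a boundary space: every element of `X` has a boundary distribution, and is determined
by it. -/
structure HasBoundarySpace (Ω : Set ℂ) (k : ℂ → ℂ) (ι : X →ₗ[ℂ] (ℂ → ℂ)) : Prop where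
  exists_boundaryValue : ∀ f : X, ∃ T : BoundaryDistribution Ω, IsBoundaryValue Ω k (ι f) T
  injective : ∀ (f f' : X) (T : BoundaryDistribution Ω),
    IsBoundaryValue Ω k (ι f) T → IsBoundaryValue Ω k (ι f') T → f = f'

variable {Ω : Set ℂ} {k : ℂ → ℂ} {ι : X →ₗ[ℂ] (ℂ → ℂ)}

/-- The trace, as a linear bijection of `X` onto its boundary distributions: see
`isBoundaryValue_traceEquiv`. -/
def traceEquiv (h : HasBoundarySpace Ω k ι) : X ≃ₗ[ℂ] boundaryValues Ω k ι :=
  LinearEquiv.ofBijective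
    { toFun := fun f => ⟨(h.exists_boundaryValue f).choose, f,
        (h.exists_boundaryValue f).choose_spec⟩
      map_add' := fun f f' => Subtype.ext <|
        (h.exists_boundaryValue (f + f')).choose_spec.unique <| by
          rw [map_add]
          exact (h.exists_boundaryValue f).choose_spec.add (h.exists_boundaryValue f').choose_spec
      map_smul' := fun c f => Subtype.ext <|
        (h.exists_boundaryValue (c • f)).choose_spec.unique <| by
          rw [map_smul]
          exact (h.exists_boundaryValue f).choose_spec.smul c }
    ⟨fun f f' hff' => h.injective f f' _ (h.exists_boundaryValue f).choose_spec (by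
        have h1 : (h.exists_boundaryValue f).choose = (h.exists_boundaryValue f').choose :=
          congrArg Subtype.val hff'
        rw [h1]
        exact (h.exists_boundaryValue f').choose_spec),
      fun T => by
        obtain ⟨T, f, hf⟩ := T
        exact ⟨f, Subtype.ext ((h.exists_boundaryValue f).choose_spec.unique hf)⟩⟩

theorem isBoundaryValue_traceEquiv (h : HasBoundarySpace Ω k ι) (f : X) :
    IsBoundaryValue Ω k (ι f) (traceEquiv h f : BoundaryDistribution Ω) :=
  (h.exists_boundaryValue f).choose_spec

/-- The boundary space `∂X`: the boundary distributions of elements of `X`, with the norm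
`‖f*‖ = ‖f‖`. -/
def BoundarySpace (_h : HasBoundarySpace Ω k ι) : Type := boundaryValues Ω k ι

instance (h : HasBoundarySpace Ω k ι) : AddCommGroup (BoundarySpace h) :=
  inferInstanceAs (AddCommGroup (boundaryValues Ω k ι))

instance (h : HasBoundarySpace Ω k ι) : Module ℂ (BoundarySpace h) :=
  inferInstanceAs (Module ℂ (boundaryValues Ω k ι))

/-- The trace `Tr : X → ∂X`, sending `f` to its boundary distribution. -/
def Tr (h : HasBoundarySpace Ω k ι) : X ≃ₗ[ℂ] BoundarySpace h := traceEquiv h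

instance (h : HasBoundarySpace Ω k ι) : NormedAddCommGroup (BoundarySpace h) :=
  NormedAddCommGroup.induced (BoundarySpace h) X (Tr h).symm (Tr h).symm.injective

instance (h : HasBoundarySpace Ω k ι) : NormedSpace ℂ (BoundarySpace h) :=
  NormedSpace.induced ℂ (BoundarySpace h) X (Tr h).symm

theorem norm_Tr (h : HasBoundarySpace Ω k ι) (f : X) : ‖Tr h f‖ = ‖f‖ := by
  change ‖(Tr h).symm (Tr h f)‖ = ‖f‖
  rw [LinearEquiv.symm_apply_apply]

/-! ### The Dirichlet-to-Robin evolution problem -/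

/-- The Wirtinger derivative `∂_z u = (∂_x u - i ∂_y u) / 2`. -/
def dz (u : ℂ → ℂ) (z : ℂ) : ℂ :=
  (fderiv ℝ u z 1 - Complex.I * fderiv ℝ u z Complex.I) / 2

/-- The graph of the Dirichlet-to-Robin operator `v ↦ (g · u + G · ∂_z u)|_{∂Ω}` in `∂X`, where
`u ∈ X` is the harmonic function on `Ω` with boundary values `v`. Thus `v` is in the domain if and
only if `g · u + G · ∂_z u` belongs to `X`. -/
def DirichletToRobin (h : HasBoundarySpace Ω k ι) (g G : ℂ → ℂ) (v w : BoundarySpace h) : Prop :=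
  ∃ u f : X, InnerProductSpace.HarmonicOnNhd (ι u) Ω ∧ Tr h u = v ∧
    (∀ z ∈ Ω, ι f z = g z * ι u z + G z * dz (ι u) z) ∧ Tr h f = w

/-- The domain of the Dirichlet-to-Robin operator. -/
def robinDomain (h : HasBoundarySpace Ω k ι) (g G : ℂ → ℂ) : Set (BoundarySpace h) :=
  {v | ∃ w, DirichletToRobin h g G v w}

/-- `v : [0, ∞) → ∂X` solves the evolution problem with initial value `v₀`: it is continuous,
`v(0) = v₀`, and for `t > 0` the derivative `v'(t)` exists in `∂X` and equals
`(g · u + G · ∂_z u)|_{∂Ω}`, where `u ∈ X` is harmonic on `Ω` with boundary values `v(t)`. -/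
structure IsSolution (h : HasBoundarySpace Ω k ι) (g G : ℂ → ℂ) (v₀ : BoundarySpace h)
    (v : ℝ → BoundarySpace h) : Prop where
  continuousOn : ContinuousOn v (Ici 0)
  initial : v 0 = v₀
  equation : ∀ t, 0 < t → ∃ w, DirichletToRobin h g G (v t) w ∧ HasDerivAt v w t

/-- A classical solution: a solution which is continuously differentiable up to `t = 0` and
satisfies the equation there too. -/
structure IsClassicalSolution (h : HasBoundarySpace Ω k ι) (g G : ℂ → ℂ) (v₀ : BoundarySpace h)
    (v : ℝ → BoundarySpace h) : Prop extends IsSolution h g G v₀ v where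
  continuously_differentiable : ∃ w : ℝ → BoundarySpace h, ContinuousOn w (Ici 0) ∧
    ∀ t, 0 ≤ t → DirichletToRobin h g G (v t) (w t) ∧ HasDerivWithinAt v (w t) (Ici 0) t

/-- A mild solution: `v` is continuous and, for all `t ≥ 0`, the integral `∫_0^t v(s) ds` lies in
the domain of the Dirichlet-to-Robin operator, which maps it to `v(t) - v₀`. -/
structure IsMildSolution (h : HasBoundarySpace Ω k ι) (g G : ℂ → ℂ) (v₀ : BoundarySpace h)
    (v : ℝ → BoundarySpace h) : Prop where
  continuousOn : ContinuousOn v (Ici 0)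
  equation : ∀ t, 0 ≤ t → DirichletToRobin h g G (∫ s in (0 : ℝ)..t, v s) (v t - v₀)

/-- Well-posedness of the evolution problem in `∂X`: the domain of the operator is dense, initial
values in the domain have classical solutions, solutions are unique, and they depend continuously
on the initial value, uniformly on compact time intervals. -/
structure IsWellPosed (h : HasBoundarySpace Ω k ι) (g G : ℂ → ℂ) : Prop where
  dense_domain : Dense (robinDomain h g G)
  existence : ∀ v₀ ∈ robinDomain h g G, ∃ v, IsClassicalSolution h g G v₀ v
  uniqueness : ∀ v₀ v v', IsSolution h g G v₀ v → IsSolution h g G v₀ v' → EqOn v v' (Ici 0)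
  stability : ∀ τ : ℝ, 0 ≤ τ → ∃ C : ℝ, ∀ v₀ v, IsSolution h g G v₀ v →
    ∀ t ∈ Icc 0 τ, ‖v t‖ ≤ C * ‖v₀‖

end Spaces

/-- `T` restricted to `[0, ∞)` is a strongly continuous operator semigroup. -/
structure IsC0Semigroup {Y : Type*} [NormedAddCommGroup Y] [NormedSpace ℂ Y]
    (T : ℝ → Y →L[ℂ] Y) : Prop where
  map_zero : T 0 = ContinuousLinearMap.id ℂ Y
  map_add : ∀ s t, 0 ≤ s → 0 ≤ t → T (s + t) = (T s).comp (T t)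
  continuousOn : ∀ y, ContinuousOn (fun t => T t y) (Ici 0)

end DirichletRobin

end

/-! The norm of `∂X` makes the trace an isometry of `X` onto `∂X`, and `∂_z u = u'` for holomorphic
`u`. The claim is thus one about the operator `u ↦ g u + G u'` on `X`, with maximal domain: it
generates the semigroup `S_t u = m_t · (u ∘ φ_t)`.

That `S` is a strongly continuous semigroup follows from the cocycle identity for `m`, the closed
graph theorem (point evaluations are continuous and separate elements of `X`), and uniform
boundedness, which spreads the continuity at `0` given by admissibility to all times
(`IsAdmissible.exists_semigroup`).

The generator is found pointwise (`generatorGraph_weightedComp_iff`). For fixed `z`, the right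
derivative of `S_t u (z)` at `0` is `g u + G u'`, so the generator is a restriction of this
operator. Conversely, if `f = g u + G u'` lies in `X`, integrating along the orbit of `z` gives
`∫_0^t S_s f (z) ds = S_t u (z) - u (z)`. Evaluations commute with the integral, so the identity
holds in `X`, and dividing by `t` puts `u` in the domain of the generator. No resolvent is needed.

The rest is the abstract Cauchy problem: every solution is an orbit, because `s ↦ T_{t-s} v(s)` is
constant, and mild solutions reduce to this by integration. -/

namespace DirichletRobin

/-! ### Right derivatives and integrals on `[0, ∞)` -/

section RightDerivatives

theorem hasDerivWithinAt_Ioi_iff {E : Type*} [NormedAddCommGroup E] [NormedSpace ℝ E]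
    {f : ℝ → E} {c : E} {t : ℝ} :
    HasDerivWithinAt f c (Ioi t) t ↔
      Tendsto (fun h : ℝ => h⁻¹ • (f (t + h) - f t)) (𝓝[>] 0) (𝓝 c) := by
  rw [hasDerivWithinAt_iff_tendsto_slope' self_notMem_Ioi]
  have h1 : 𝓝[>] t = map (fun h => t + h) (𝓝[>] (0 : ℝ)) := by simp
  rw [h1, tendsto_map'_iff]
  refine tendsto_congr fun h => ?_
  simp [slope_def_module]

/-- The bound is uniform in the base point, so continuity from the left comes for free: for `s < t`
it is applied at `s` with step `t - s`. This serves both operator orbits and orbits of the semiflow.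
-/
theorem continuousOn_Icc_of_dist_le {M : Type*} [PseudoMetricSpace M] {x : ℝ → M} {β : ℝ → ℝ}
    {τ : ℝ} (hβ : Tendsto β (𝓝[>] 0) (𝓝 0))
    (hx : ∀ᶠ h in 𝓝[>] 0, ∀ s ∈ Icc 0 τ, dist (x (s + h)) (x s) ≤ β h) :
    ContinuousOn x (Icc 0 τ) := by
  intro t ht
  refine Metric.continuousWithinAt_iff.2 fun ε hε => ?_
  obtain ⟨δ, hδ, hδ'⟩ := mem_nhdsGT_iff_exists_Ioo_subset.1
    (hx.and (hβ.eventually (gt_mem_nhds hε)))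
  refine ⟨δ, hδ, fun {s} hs hst => ?_⟩
  rw [Real.dist_eq] at hst
  rcases lt_trichotomy s t with h | rfl | h
  · rw [abs_sub_comm, abs_of_pos (sub_pos.2 h)] at hst
    have h1 := hδ' ⟨sub_pos.2 h, hst⟩
    have h2 := h1.1 s hs
    rw [add_sub_cancel, dist_comm] at h2
    exact h2.trans_lt h1.2
  · simpa using hε
  · rw [abs_of_pos (sub_pos.2 h)] at hst
    have h1 := hδ' ⟨sub_pos.2 h, hst⟩
    have h2 := h1.1 t ht
    rw [add_sub_cancel] at h2
    exact h2.trans_lt h1.2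

theorem continuousOn_Ici_of_Icc {M : Type*} [TopologicalSpace M] {x : ℝ → M}
    (hx : ∀ τ, ContinuousOn x (Icc 0 τ)) : ContinuousOn x (Ici 0) := by
  intro t ht
  have h1 := hx (t + 1) t ⟨ht, by linarith⟩
  refine h1.mono_of_mem_nhdsWithin ?_
  rw [← Ici_inter_Iic]
  exact inter_mem_nhdsWithin _ (Iic_mem_nhds (by linarith))

theorem intervalIntegrable_of_continuousOn_Ici {E : Type*} [NormedAddCommGroup E]
    {f : ℝ → E} (hf : ContinuousOn f (Ici 0)) {a b : ℝ} (ha : 0 ≤ a) (hb : 0 ≤ b) :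
    IntervalIntegrable f volume a b :=
  (hf.mono fun _ hx => (le_min ha hb).trans hx.1).intervalIntegrable

theorem hasDerivAt_integral_of_continuousOn_Ici {E : Type*} [NormedAddCommGroup E]
    [NormedSpace ℝ E] [CompleteSpace E] {f : ℝ → E} (hf : ContinuousOn f (Ici 0)) {t : ℝ}
    (ht : 0 < t) : HasDerivAt (fun t => ∫ s in (0 : ℝ)..t, f s) (f t) t :=
  intervalIntegral.integral_hasDerivAt_right
    (intervalIntegrable_of_continuousOn_Ici hf le_rfl ht.le)
    (hf.stronglyMeasurableAtFilter_nhdsWithin measurableSet_Ici t |>.filter_mono (by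
      rw [nhdsWithin_eq_nhds.2 (Ici_mem_nhds ht)]))
    (hf.continuousAt (Ici_mem_nhds ht))

theorem hasDerivWithinAt_integral_of_continuousOn_Ici {E : Type*} [NormedAddCommGroup E]
    [NormedSpace ℝ E] [CompleteSpace E] {f : ℝ → E} (hf : ContinuousOn f (Ici 0)) {t : ℝ}
    (ht : 0 ≤ t) : HasDerivWithinAt (fun t => ∫ s in (0 : ℝ)..t, f s) (f t) (Ici 0) t := by
  rcases ht.eq_or_lt with rfl | ht
  · have : HasDerivWithinAt (fun t => ∫ s in (0 : ℝ)..t, f s) (f 0) (Ici 0) 0 :=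
      intervalIntegral.integral_hasDerivWithinAt_right (by simp)
        ((hf.stronglyMeasurableAtFilter_nhdsWithin measurableSet_Ici 0).filter_mono
          (nhdsWithin_mono _ Ioi_subset_Ici_self)) ((hf 0 self_mem_Ici).mono Ioi_subset_Ici_self)
    exact this
  · exact (hasDerivAt_integral_of_continuousOn_Ici hf ht).hasDerivWithinAt

theorem continuousOn_integral_of_continuousOn_Ici {E : Type*} [NormedAddCommGroup E]
    [NormedSpace ℝ E] [CompleteSpace E] {f : ℝ → E} (hf : ContinuousOn f (Ici 0)) :
    ContinuousOn (fun t => ∫ s in (0 : ℝ)..t, f s) (Ici 0) :=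
  fun _ ht => (hasDerivWithinAt_integral_of_continuousOn_Ici hf ht).continuousWithinAt

end RightDerivatives

/-! ### Strongly continuous semigroups and the abstract Cauchy problem -/

section Semigroups

variable {Y : Type*} [NormedAddCommGroup Y] [NormedSpace ℂ Y]

/-- The graph of the generator of the operator semigroup `T`. -/
def GeneratorGraph (T : ℝ → Y →L[ℂ] Y) (v w : Y) : Prop :=
  Tendsto (fun t : ℝ => ((t : ℂ)⁻¹) • (T t v - v)) (𝓝[>] 0) (𝓝 w)

theorem generatorGraph_iff {T : ℝ → Y →L[ℂ] Y} {v w : Y} :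
    GeneratorGraph T v w ↔
      Tendsto (fun t : ℝ => t⁻¹ • (T t v - v)) (𝓝[>] 0) (𝓝 w) := by
  refine tendsto_congr fun t => ?_
  rw [← Complex.ofReal_inv, Complex.coe_smul]

theorem GeneratorGraph.unique {T : ℝ → Y →L[ℂ] Y} {v w w' : Y} (h : GeneratorGraph T v w)
    (h' : GeneratorGraph T v w') : w = w' := tendsto_nhds_unique h h'

theorem GeneratorGraph.sub {T : ℝ → Y →L[ℂ] Y} {v v' w w' : Y} (h : GeneratorGraph T v w)
    (h' : GeneratorGraph T v' w') : GeneratorGraph T (v - v') (w - w') := by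
  refine (Tendsto.sub h h').congr fun t => ?_
  rw [map_sub, ← smul_sub]
  congr 1
  abel

theorem exists_norm_le_of_tendsto [CompleteSpace Y] {S : ℝ → Y →L[ℂ] Y}
    (hS : ∀ y, Tendsto (fun t => S t y) (𝓝[>] 0) (𝓝 y)) :
    ∃ δ > 0, ∃ C, ∀ t ∈ Ioo 0 δ, ‖S t‖ ≤ C := by
  by_contra! hcon
  -- Negating with `δ = 1 / (n + 1)` and `C = n` gives times tending to `0` along which the norms
  -- are unbounded although every orbit converges, against Banach–Steinhaus.
  choose! t ht ht' using fun n : ℕ => hcon (1 / ((n : ℝ) + 1)) Nat.one_div_pos_of_nat n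
  have h1 : Tendsto t atTop (𝓝[>] 0) := tendsto_nhdsWithin_iff.2
    ⟨squeeze_zero (fun n => (ht n).1.le) (fun n => (ht n).2.le)
      tendsto_one_div_add_atTop_nhds_zero_nat,
      Eventually.of_forall fun n => (ht n).1⟩
  obtain ⟨C, hC⟩ := banach_steinhaus (g := fun n => S (t n)) fun y => by
    obtain ⟨C, hC⟩ := ((hS y).comp h1).norm.bddAbove_range
    exact ⟨C, fun n => hC ⟨n, rfl⟩⟩
  obtain ⟨n, hn⟩ := exists_nat_gt C
  exact absurd ((ht' n).trans_le (hC n)) hn.not_gt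

theorem IsC0Semigroup.of_tendsto [CompleteSpace Y] {S : ℝ → Y →L[ℂ] Y}
    (hzero : S 0 = ContinuousLinearMap.id ℂ Y)
    (hadd : ∀ s t, 0 ≤ s → 0 ≤ t → S (s + t) = (S s).comp (S t))
    (hS : ∀ y, Tendsto (fun t => S t y) (𝓝[>] 0) (𝓝 y)) : IsC0Semigroup S := by
  refine ⟨hzero, hadd, fun y => continuousOn_Ici_of_Icc fun τ => ?_⟩
  obtain ⟨δ, hδ, C, hC⟩ := exists_norm_le_of_tendsto hS
  have hC0 : 0 ≤ C := (norm_nonneg _).trans (hC (δ / 2) ⟨by linarith, by linarith⟩)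
  -- Local boundedness is propagated in steps of `δ / 2`, since the initial bound is available only
  -- on the open interval `(0, δ)`.
  have key : ∀ n : ℕ, ∃ D, ∀ s ∈ Icc 0 (n * (δ / 2)), ‖S s‖ ≤ D := by
    intro n
    induction n with
    | zero =>
      refine ⟨‖S 0‖, fun s hs => ?_⟩
      have : s = 0 := le_antisymm (by simpa using hs.2) hs.1
      rw [this]
    | succ n ih =>
      obtain ⟨D, hD⟩ := ih
      refine ⟨max D (D * C), fun s hs => ?_⟩
      rcases le_or_gt s (n * (δ / 2)) with h | h
      · exact (hD s ⟨hs.1, h⟩).trans (le_max_left _ _)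
      · have hn : 0 ≤ (n : ℝ) * (δ / 2) := by positivity
        have h2 : s ≤ (n + 1) * (δ / 2) := by simpa using hs.2
        have h3 := hadd (n * (δ / 2)) (s - n * (δ / 2)) hn (by linarith)
        rw [add_sub_cancel] at h3
        rw [h3]
        refine (ContinuousLinearMap.opNorm_comp_le _ _).trans ((mul_le_mul (hD _ ⟨hn, le_rfl⟩)
          (hC _ ⟨by linarith, by linarith⟩) (norm_nonneg _) ?_).trans (le_max_right _ _))
        exact (norm_nonneg _).trans (hD _ ⟨hn, le_rfl⟩)
  obtain ⟨n, hn⟩ := exists_nat_gt (τ / (δ / 2))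
  obtain ⟨D, hD⟩ := key n
  rw [div_lt_iff₀ (by linarith)] at hn
  refine continuousOn_Icc_of_dist_le (β := fun h => D * dist (S h y) y) ?_ ?_
  · simpa using (tendsto_iff_dist_tendsto_zero.1 (hS y)).const_mul D
  · filter_upwards [self_mem_nhdsWithin] with h hh s hs
    -- `S_{s+h} y - S_s y = S_s (S_h y - y)`, with `‖S_s‖ ≤ D` uniformly in `s`.
    rw [hadd s h hs.1 (le_of_lt hh), dist_eq_norm, dist_eq_norm, ContinuousLinearMap.comp_apply,
      ← map_sub]
    exact (S s).le_of_opNorm_le (hD s ⟨hs.1, hs.2.trans hn.le⟩) _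

namespace IsC0Semigroup

variable {T : ℝ → Y →L[ℂ] Y}

theorem apply_zero (hT : IsC0Semigroup T) (y : Y) : T 0 y = y := by
  simp [hT.map_zero]

theorem apply_add (hT : IsC0Semigroup T) {s t : ℝ} (hs : 0 ≤ s) (ht : 0 ≤ t) (y : Y) :
    T (s + t) y = T s (T t y) := by
  simp [hT.map_add s t hs ht]

theorem apply_comm (hT : IsC0Semigroup T) {s t : ℝ} (hs : 0 ≤ s) (ht : 0 ≤ t) (y : Y) :
    T s (T t y) = T t (T s y) := by
  rw [← hT.apply_add hs ht, add_comm, hT.apply_add ht hs]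

theorem exists_norm_le [CompleteSpace Y] (hT : IsC0Semigroup T) (τ : ℝ) :
    ∃ C, 0 ≤ C ∧ ∀ t ∈ Icc 0 τ, ‖T t‖ ≤ C := by
  obtain ⟨C, hC⟩ := banach_steinhaus (g := fun t : Icc 0 τ => T t) fun y => by
    obtain ⟨C, hC⟩ := isCompact_Icc.exists_bound_of_continuousOn
      ((hT.continuousOn y).mono (Icc_subset_Ici_self (a := τ) (b := 0)))
    exact ⟨C, fun t => hC t t.2⟩
  exact ⟨max C 0, le_max_right _ _, fun t ht => (hC ⟨t, ht⟩).trans (le_max_left _ _)⟩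

/-- Joint continuity in time and vector: local boundedness controls `T_a (y - z)`, strong continuity
controls `T_a z`. -/
theorem tendsto_apply [CompleteSpace Y] (hT : IsC0Semigroup T) {α : Type*} {l : Filter α}
    {a : α → ℝ} {y : α → Y} {t : ℝ} {z : Y} (ha0 : ∀ᶠ i in l, 0 ≤ a i) (ht : 0 ≤ t)
    (ha : Tendsto a l (𝓝 t)) (hy : Tendsto y l (𝓝 z)) :
    Tendsto (fun i => T (a i) (y i)) l (𝓝 (T t z)) := by
  obtain ⟨C, hC0, hC⟩ := hT.exists_norm_le (t + 1)
  have h1 : Tendsto (fun i => T (a i) z) l (𝓝 (T t z)) :=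
    (hT.continuousOn z t ht).tendsto.comp (tendsto_nhdsWithin_iff.2 ⟨ha, ha0⟩)
  have h2 : Tendsto (fun i => T (a i) (y i - z)) l (𝓝 0) := by
    refine squeeze_zero_norm' (a := fun i => C * ‖y i - z‖) ?_ ?_
    · filter_upwards [ha0, ha.eventually (ge_mem_nhds (lt_add_one t))] with i h h'
      exact (T (a i)).le_of_opNorm_le (hC _ ⟨h, h'⟩) _
    · simpa using (tendsto_iff_norm_sub_tendsto_zero.1 hy).const_mul C
  simpa using h2.add h1

theorem generatorGraph_apply (hT : IsC0Semigroup T) {v w : Y} (h : GeneratorGraph T v w) {t : ℝ}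
    (ht : 0 ≤ t) : GeneratorGraph T (T t v) (T t w) := by
  refine (((T t).continuous.tendsto w).comp h).congr' ?_
  filter_upwards [self_mem_nhdsWithin] with s hs
  simp [hT.apply_comm (le_of_lt hs) ht]

theorem hasDerivWithinAt_Ioi (hT : IsC0Semigroup T) {v w : Y} (h : GeneratorGraph T v w) {t : ℝ}
    (ht : 0 ≤ t) : HasDerivWithinAt (fun s => T s v) (T t w) (Ioi t) t := by
  rw [hasDerivWithinAt_Ioi_iff]
  refine (generatorGraph_iff.1 (hT.generatorGraph_apply h ht)).congr' ?_
  filter_upwards [self_mem_nhdsWithin] with s hs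
  rw [add_comm, hT.apply_add (le_of_lt hs) ht]

theorem integral_apply [CompleteSpace Y] (hT : IsC0Semigroup T) {v w : Y}
    (h : GeneratorGraph T v w) {t : ℝ} (ht : 0 ≤ t) :
    ∫ s in (0 : ℝ)..t, T s w = T t v - v := by
  rw [intervalIntegral.integral_eq_sub_of_hasDeriv_right (f := fun s => T s v), hT.apply_zero]
  · rw [uIcc_of_le ht]
    exact (hT.continuousOn v).mono Icc_subset_Ici_self
  · intro x hx
    rw [min_eq_left ht] at hx
    exact hT.hasDerivWithinAt_Ioi h hx.1.le
  · exact intervalIntegrable_of_continuousOn_Ici (hT.continuousOn w) le_rfl ht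

/-- The test for membership in the generator: unlike the limit of difference quotients, the integral
identity can be checked by point evaluations. -/
theorem generatorGraph_of_integral [CompleteSpace Y] (hT : IsC0Semigroup T) {v w : Y}
    (h : ∀ t, 0 ≤ t → ∫ s in (0 : ℝ)..t, T s w = T t v - v) : GeneratorGraph T v w := by
  rw [generatorGraph_iff]
  have h1 := (hasDerivWithinAt_integral_of_continuousOn_Ici (hT.continuousOn w)
    (le_refl 0)).mono Ioi_subset_Ici_self
  rw [hasDerivWithinAt_Ioi_iff, hT.apply_zero] at h1
  refine h1.congr' ?_
  filter_upwards [self_mem_nhdsWithin] with s hs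
  simp [h s (le_of_lt hs)]

/-- The semigroup law yields only right derivatives. The orbit of `v` is `v` plus the integral of
the continuous orbit of `w`, which gives the left derivative as well. -/
theorem hasDerivWithinAt [CompleteSpace Y] (hT : IsC0Semigroup T) {v w : Y}
    (h : GeneratorGraph T v w) {t : ℝ} (ht : 0 ≤ t) :
    HasDerivWithinAt (fun s => T s v) (T t w) (Ici 0) t := by
  have h1 := (hasDerivWithinAt_integral_of_continuousOn_Ici (hT.continuousOn w) ht).add_const v
  refine h1.congr (fun s hs => ?_) ?_
  · simp [hT.integral_apply h hs]
  · simp [hT.integral_apply h ht]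

/-- `T_r` shifts the window of integration, so `(T_r - 1) ∫_0^t = ∫_t^{t+r} - ∫_0^r`; divided by
`r`, the two short integrals tend to `T_t y` and `y`. -/
theorem generatorGraph_integral [CompleteSpace Y] (hT : IsC0Semigroup T) (y : Y) {t : ℝ}
    (ht : 0 ≤ t) : GeneratorGraph T (∫ s in (0 : ℝ)..t, T s y) (T t y - y) := by
  have hc := hT.continuousOn y
  have h1 : HasDerivWithinAt (fun t => ∫ s in (0 : ℝ)..t, T s y) (T t y) (Ioi t) t :=
    (hasDerivWithinAt_integral_of_continuousOn_Ici hc ht).mono fun x hx => ht.trans (le_of_lt hx)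
  have h2 : HasDerivWithinAt (fun t => ∫ s in (0 : ℝ)..t, T s y) (T 0 y) (Ioi 0) 0 :=
    (hasDerivWithinAt_integral_of_continuousOn_Ici hc le_rfl).mono Ioi_subset_Ici_self
  rw [hasDerivWithinAt_Ioi_iff] at h1 h2
  rw [generatorGraph_iff]
  rw [hT.apply_zero] at h2
  refine (h1.sub h2).congr' ?_
  filter_upwards [self_mem_nhdsWithin] with r hr
  replace hr : 0 ≤ r := le_of_lt hr
  have h3 : T r (∫ s in (0 : ℝ)..t, T s y) = ∫ s in r..(t + r), T s y := by
    rw [← (T r).intervalIntegral_comp_comm (intervalIntegrable_of_continuousOn_Ici hc le_rfl ht)]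
    have := intervalIntegral.integral_comp_add_right (a := 0) (b := t) (fun s => T s y) r
    rw [zero_add] at this
    rw [← this]
    refine intervalIntegral.integral_congr fun s hs => ?_
    rw [uIcc_of_le ht] at hs
    rw [add_comm, hT.apply_add hr hs.1]
  have h4 := intervalIntegral.integral_add_adjacent_intervals
    (intervalIntegrable_of_continuousOn_Ici hc le_rfl hr)
    (intervalIntegrable_of_continuousOn_Ici hc hr (add_nonneg ht hr))
  rw [h3, ← smul_sub, ← h4]
  congr 1
  simp
  abel

/-- The averages `s⁻¹ ∫_0^s T_r y dr` lie in the domain and tend to `y` as `s → 0+`. -/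
theorem dense_generator_domain [CompleteSpace Y] (hT : IsC0Semigroup T) :
    Dense {v | ∃ w, GeneratorGraph T v w} := by
  intro y
  have h1 := (hasDerivWithinAt_integral_of_continuousOn_Ici (hT.continuousOn y)
    (le_refl 0)).mono Ioi_subset_Ici_self
  rw [hasDerivWithinAt_Ioi_iff, hT.apply_zero] at h1
  refine mem_closure_of_tendsto h1 ?_
  filter_upwards [self_mem_nhdsWithin] with s hs
  refine ⟨(s : ℂ)⁻¹ • (T s y - y), ?_⟩
  refine ((hT.generatorGraph_integral y (le_of_lt hs)).const_smul ((s : ℂ)⁻¹)).congr fun r => ?_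
  rw [← Complex.coe_smul, Complex.ofReal_inv]
  simp only [zero_add, intervalIntegral.integral_same, sub_zero, map_smul]
  rw [smul_comm, smul_sub (s : ℂ)⁻¹]

/-- A continuous solution of the abstract Cauchy problem is an orbit of the semigroup. -/
theorem eq_of_hasDerivAt [CompleteSpace Y] (hT : IsC0Semigroup T) {v : ℝ → Y}
    (hv : ContinuousOn v (Ici 0))
    (hderiv : ∀ t, 0 < t → ∃ w, GeneratorGraph T (v t) w ∧ HasDerivAt v w t) {t : ℝ}
    (ht : 0 ≤ t) : v t = T t (v 0) := by
  -- The function `s ↦ T_{t-s} v(s)` joins `T_t v(0)` to `v(t)` and has right derivative `0` on `(0,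
  -- t)`.
  have key : ∫ _ in (0 : ℝ)..t, (0 : Y) = T (t - t) (v t) - T (t - 0) (v 0) := by
    refine intervalIntegral.integral_eq_sub_of_hasDeriv_right (f := fun s => T (t - s) (v s))
      (f' := fun _ => 0) ?_ ?_ (by simp)
    · rw [uIcc_of_le ht]
      intro s hs
      refine hT.tendsto_apply ?_ (sub_nonneg.2 hs.2) ?_ ((hv s hs.1).mono Icc_subset_Ici_self)
      · filter_upwards [self_mem_nhdsWithin] with r hr using sub_nonneg.2 hr.2
      · exact ((continuous_const.sub continuous_id).tendsto s).mono_left nhdsWithin_le_nhds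
    · intro s hs
      rw [min_eq_left ht, max_eq_right ht] at hs
      obtain ⟨w, hw, hw'⟩ := hderiv s hs.1
      rw [hasDerivWithinAt_Ioi_iff]
      have h0 : Tendsto (fun r : ℝ => t - (s + r)) (𝓝[>] 0) (𝓝 (t - s)) := by
        have : Continuous fun r : ℝ => t - (s + r) := by fun_prop
        simpa using (this.tendsto 0).mono_left (nhdsWithin_le_nhds (s := Ioi 0))
      have hev : ∀ᶠ r : ℝ in 𝓝[>] 0, 0 ≤ t - (s + r) :=
        h0.eventually (le_mem_nhds (sub_pos.2 hs.2))
      -- The difference quotient is `T_{t-s-r}` applied to the difference of the quotients of `v`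
      -- and of `r ↦ T_r v(s)`; both tend to `w`.
      have h1 : Tendsto (fun r : ℝ => T (t - (s + r)) (r⁻¹ • (v (s + r) - v s))) (𝓝[>] 0)
          (𝓝 (T (t - s) w)) :=
        hT.tendsto_apply hev (sub_pos.2 hs.2).le h0
          (hasDerivWithinAt_Ioi_iff.1 hw'.hasDerivWithinAt)
      have h2 : Tendsto (fun r : ℝ => T (t - (s + r)) (r⁻¹ • (T r (v s) - v s))) (𝓝[>] 0)
          (𝓝 (T (t - s) w)) :=
        hT.tendsto_apply hev (sub_pos.2 hs.2).le h0 (generatorGraph_iff.1 hw)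
      have h3 := h1.sub h2
      rw [sub_self] at h3
      refine h3.congr' ?_
      filter_upwards [hev, self_mem_nhdsWithin] with r hr hr'
      have h4 : T (t - s) (v s) = T (t - (s + r)) (T r (v s)) := by
        rw [← hT.apply_add hr (le_of_lt hr')]
        congr 2
        ring
      rw [h4, ← map_sub, ← map_sub, ← smul_sub, sub_sub_sub_cancel_right]
      rw [← Complex.coe_smul, ← Complex.coe_smul, map_smul]
  simpa [hT.apply_zero, eq_comm (a := (0 : Y)), sub_eq_zero] using key

theorem mild_iff [CompleteSpace Y] (hT : IsC0Semigroup T) {v : ℝ → Y} {v₀ : Y} :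
    (ContinuousOn v (Ici 0) ∧
      ∀ t, 0 ≤ t → GeneratorGraph T (∫ s in (0 : ℝ)..t, v s) (v t - v₀)) ↔
    EqOn v (fun t => T t v₀) (Ici 0) := by
  constructor
  · rintro ⟨hv, hv'⟩
    have hc := hT.continuousOn v₀
    -- The difference of the two integrals starts at `0` and solves the Cauchy problem: its
    -- derivative is `v - T v₀ = (v - v₀) - (T v₀ - v₀)`. Hence it vanishes, and single-valuedness
    -- of the generator then gives `v = T v₀`.
    have h1 : ∀ t, 0 ≤ t →
        (∫ s in (0 : ℝ)..t, v s) - ∫ s in (0 : ℝ)..t, T s v₀ = 0 := by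
      intro t ht
      rw [hT.eq_of_hasDerivAt
        (v := fun t => (∫ s in (0 : ℝ)..t, v s) - ∫ s in (0 : ℝ)..t, T s v₀) ?_ ?_ ht]
      · simp
      · exact (continuousOn_integral_of_continuousOn_Ici hv).sub
          (continuousOn_integral_of_continuousOn_Ici hc)
      · intro s hs
        refine ⟨_, (hv' s hs.le).sub (hT.generatorGraph_integral v₀ hs.le), ?_⟩
        rw [sub_sub_sub_cancel_right]
        exact (hasDerivAt_integral_of_continuousOn_Ici hv hs).sub
          (hasDerivAt_integral_of_continuousOn_Ici hc hs)
    intro t ht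
    have h2 := hv' t ht
    rw [sub_eq_zero.1 (h1 t ht)] at h2
    exact sub_left_injective (h2.unique (hT.generatorGraph_integral v₀ ht))
  · intro h
    refine ⟨(hT.continuousOn v₀).congr h, fun t ht => ?_⟩
    have h1 : ∫ s in (0 : ℝ)..t, v s = ∫ s in (0 : ℝ)..t, T s v₀ := by
      refine intervalIntegral.integral_congr fun s hs => h ?_
      rw [uIcc_of_le ht] at hs
      exact hs.1
    rw [h1, h ht]
    exact hT.generatorGraph_integral v₀ ht

end IsC0Semigroup

end Semigroups

/-! ### Semiflow orbits, the cocycle, and pointwise differentiation -/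

section Semiflow

variable {Ω : Set ℂ} {φ : ℝ → ℂ → ℂ} {g G : ℂ → ℂ}

/-- Schwarz's lemma on a disc of radius `r` about `z` makes all `φ_s` Lipschitz at `z` with the same
constant `diam Ω / r`, so continuity at time `0` spreads to all times. -/
theorem IsHolomorphicSemiflow.continuousOn_time (hφ : IsHolomorphicSemiflow Ω φ)
    (hΩ : IsOpen Ω) (hb : Bornology.IsBounded Ω) {z : ℂ} (hz : z ∈ Ω) :
    ContinuousOn (fun t => φ t z) (Ici 0) := by
  obtain ⟨r, hr, hrΩ⟩ := Metric.isOpen_iff.1 hΩ z hz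
  have h0 := hφ.tendsto_zero z hz
  refine continuousOn_Ici_of_Icc fun τ => continuousOn_Icc_of_dist_le
    (β := fun h => Metric.diam Ω / r * dist (φ h z) z) ?_ ?_
  · simpa using (tendsto_iff_dist_tendsto_zero.1 h0).const_mul (Metric.diam Ω / r)
  · filter_upwards [self_mem_nhdsWithin, h0.eventually (Metric.ball_mem_nhds z hr)]
      with h hh hball s hs
    rw [hφ.map_add s h hs.1 (le_of_lt hh) z hz]
    refine Complex.dist_le_div_mul_dist_of_mapsTo_ball
      ((hφ.holomorphic s hs.1).mono hrΩ) (fun w hw => ?_) hball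
    exact Metric.dist_le_diam_of_mem hb (hφ.mapsTo s hs.1 (hrΩ hw)) (hφ.mapsTo s hs.1 hz)

theorem IsHolomorphicSemiflow.continuousOn_comp (hφ : IsHolomorphicSemiflow Ω φ)
    (hΩ : IsOpen Ω) (hb : Bornology.IsBounded Ω) {f : ℂ → ℂ} (hf : ContinuousOn f Ω) {z : ℂ}
    (hz : z ∈ Ω) : ContinuousOn (fun t => f (φ t z)) (Ici 0) :=
  hf.comp (hφ.continuousOn_time hΩ hb hz) fun t ht => hφ.mapsTo t ht hz

theorem cocycle_add (hφ : IsHolomorphicSemiflow Ω φ) (hΩ : IsOpen Ω)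
    (hb : Bornology.IsBounded Ω) (hg : ContinuousOn g Ω) {s t : ℝ} (hs : 0 ≤ s) (ht : 0 ≤ t)
    {z : ℂ} (hz : z ∈ Ω) :
    cocycle φ g (s + t) z = cocycle φ g t z * cocycle φ g s (φ t z) := by
  have hc := hφ.continuousOn_comp hΩ hb hg hz
  rw [cocycle, cocycle, cocycle, ← Complex.exp_add]
  congr 1
  rw [← intervalIntegral.integral_add_adjacent_intervals
    (intervalIntegrable_of_continuousOn_Ici hc le_rfl ht)
    (intervalIntegrable_of_continuousOn_Ici hc ht (add_nonneg hs ht))]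
  congr 1
  have := intervalIntegral.integral_comp_add_right (a := 0) (b := s) (fun r => g (φ r z)) t
  rw [zero_add] at this
  rw [← this]
  refine intervalIntegral.integral_congr fun r hr => ?_
  rw [uIcc_of_le hs] at hr
  simp only [hφ.map_add r t hr.1 ht z hz]

theorem continuousOn_cocycle (hφ : IsHolomorphicSemiflow Ω φ) (hΩ : IsOpen Ω)
    (hb : Bornology.IsBounded Ω) (hg : ContinuousOn g Ω) {z : ℂ} (hz : z ∈ Ω) :
    ContinuousOn (fun t => cocycle φ g t z) (Ici 0) :=
  (continuousOn_integral_of_continuousOn_Ici (hφ.continuousOn_comp hΩ hb hg hz)).cexp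

theorem weightedComp_zero (hφ : IsHolomorphicSemiflow Ω φ) (f : ℂ → ℂ) {z : ℂ} (hz : z ∈ Ω) :
    weightedComp φ g 0 f z = f z := by
  simp [weightedComp, cocycle, hφ.map_zero z hz]

theorem weightedComp_add (hφ : IsHolomorphicSemiflow Ω φ) (hΩ : IsOpen Ω)
    (hb : Bornology.IsBounded Ω) (hg : ContinuousOn g Ω) (f : ℂ → ℂ) {s t : ℝ} (hs : 0 ≤ s)
    (ht : 0 ≤ t) {z : ℂ} (hz : z ∈ Ω) :
    weightedComp φ g (s + t) f z = cocycle φ g t z * weightedComp φ g s f (φ t z) := by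
  rw [weightedComp, cocycle_add hφ hΩ hb hg hs ht hz, hφ.map_add s t hs ht z hz, mul_assoc,
    weightedComp]

theorem continuousOn_weightedComp (hφ : IsHolomorphicSemiflow Ω φ) (hΩ : IsOpen Ω)
    (hb : Bornology.IsBounded Ω) (hg : ContinuousOn g Ω) {f : ℂ → ℂ} (hf : ContinuousOn f Ω)
    {z : ℂ} (hz : z ∈ Ω) : ContinuousOn (fun t => weightedComp φ g t f z) (Ici 0) :=
  (continuousOn_cocycle hφ hΩ hb hg hz).mul (hφ.continuousOn_comp hΩ hb hf hz)

theorem hasDerivWithinAt_weightedComp_zero (hφ : IsHolomorphicSemiflow Ω φ) (hΩ : IsOpen Ω)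
    (hb : Bornology.IsBounded Ω) (hG : IsSemiflowGenerator Ω φ G) (hg : ContinuousOn g Ω)
    {f : ℂ → ℂ} (hf : DifferentiableOn ℂ f Ω) {z : ℂ} (hz : z ∈ Ω) :
    HasDerivWithinAt (fun t => weightedComp φ g t f z) (g z * f z + G z * deriv f z)
      (Ioi 0) 0 := by
  have hz0 := hφ.map_zero z hz
  have h1 : HasDerivWithinAt (fun t => cocycle φ g t z) (g z) (Ioi 0) 0 := by
    have := ((hasDerivWithinAt_integral_of_continuousOn_Ici (hφ.continuousOn_comp hΩ hb hg hz)
      (le_refl 0)).mono Ioi_subset_Ici_self).cexp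
    exact this.congr_deriv (by simp [hz0])
  have h2 : HasDerivWithinAt (fun t => φ t z) (G z) (Ioi 0) 0 := by
    rw [hasDerivWithinAt_Ioi_iff]
    refine (hG z hz).congr fun t => ?_
    rw [zero_add, hz0, ← Complex.coe_smul, Complex.ofReal_inv, smul_eq_mul, div_eq_inv_mul]
  have h3 : HasDerivAt f (deriv f z) (φ 0 z) := by
    rw [hz0]
    exact (hf.differentiableAt (hΩ.mem_nhds hz)).hasDerivAt
  have h4 := h1.mul (h3.comp_hasDerivWithinAt 0 h2)
  have h5 : cocycle φ g 0 z = 1 := by simp [cocycle]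
  simp only [Function.comp_apply, hz0, h5, one_mul] at h4
  rw [mul_comm (G z)]
  exact h4

/-- Since `S_{t+s} f (z) = m_t(z) · S_s f (φ_t z)`, only the derivative at time `0`, taken at the
point `φ_t z`, is required; `φ_t` is never differentiated in `z`. -/
theorem hasDerivWithinAt_weightedComp (hφ : IsHolomorphicSemiflow Ω φ) (hΩ : IsOpen Ω)
    (hb : Bornology.IsBounded Ω) (hG : IsSemiflowGenerator Ω φ G) (hg : ContinuousOn g Ω)
    {f : ℂ → ℂ} (hf : DifferentiableOn ℂ f Ω) {z : ℂ} (hz : z ∈ Ω) {t : ℝ} (ht : 0 ≤ t) :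
    HasDerivWithinAt (fun t => weightedComp φ g t f z)
      (weightedComp φ g t (fun z => g z * f z + G z * deriv f z) z) (Ioi t) t := by
  have htz := hφ.mapsTo t ht hz
  have h1 := (hasDerivWithinAt_Ioi_iff.1
    (hasDerivWithinAt_weightedComp_zero hφ hΩ hb hG hg hf htz)).const_mul (cocycle φ g t z)
  rw [hasDerivWithinAt_Ioi_iff]
  refine h1.congr' ?_
  filter_upwards [self_mem_nhdsWithin] with s hs
  have h2 : weightedComp φ g t f z = cocycle φ g t z * weightedComp φ g 0 f (φ t z) := by
    rw [weightedComp_zero hφ f htz, weightedComp]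
  rw [add_comm t s, weightedComp_add hφ hΩ hb hg f (le_of_lt hs) ht hz, h2, ← mul_sub,
    mul_smul_comm, zero_add]

/-- The integrand is continuous because `f` is, so no regularity of `G` enters. -/
theorem integral_weightedComp (hφ : IsHolomorphicSemiflow Ω φ) (hΩ : IsOpen Ω)
    (hb : Bornology.IsBounded Ω) (hG : IsSemiflowGenerator Ω φ G) (hg : ContinuousOn g Ω)
    {u f : ℂ → ℂ} (hu : DifferentiableOn ℂ u Ω) (hf : ContinuousOn f Ω)
    (huf : ∀ z ∈ Ω, f z = g z * u z + G z * deriv u z) {z : ℂ} (hz : z ∈ Ω) {t : ℝ}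
    (ht : 0 ≤ t) :
    ∫ s in (0 : ℝ)..t, weightedComp φ g s f z = weightedComp φ g t u z - u z := by
  rw [intervalIntegral.integral_eq_sub_of_hasDeriv_right (f := fun s => weightedComp φ g s u z),
    weightedComp_zero hφ u hz]
  · rw [uIcc_of_le ht]
    exact (continuousOn_weightedComp hφ hΩ hb hg hu.continuousOn hz).mono Icc_subset_Ici_self
  · intro s hs
    rw [min_eq_left ht] at hs
    have := hasDerivWithinAt_weightedComp hφ hΩ hb hG hg hu hz hs.1.le
    rwa [weightedComp, ← huf _ (hφ.mapsTo s hs.1.le hz)] at this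
  · exact intervalIntegrable_of_continuousOn_Ici
      (continuousOn_weightedComp hφ hΩ hb hg hf hz) le_rfl ht

end Semiflow

/-! ### The weighted composition semigroup on `X` and its generator -/

section Operators

variable {Ω : Set ℂ} {φ : ℝ → ℂ → ℂ} {g G : ℂ → ℂ}
  {X : Type*} [NormedAddCommGroup X] [NormedSpace ℂ X] {ι : X →ₗ[ℂ] (ℂ → ℂ)}

/-- Point evaluation at a point of the domain, as a continuous functional. -/
noncomputable def IsHolomorphicFunctionSpace.evalCLM (hX : IsHolomorphicFunctionSpace Ω ι) {z : ℂ}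
    (hz : z ∈ Ω) : X →L[ℂ] ℂ :=
  ⟨(LinearMap.proj z).comp ι, hX.continuous_eval z hz⟩

theorem IsHolomorphicFunctionSpace.evalCLM_apply (hX : IsHolomorphicFunctionSpace Ω ι) {z : ℂ}
    (hz : z ∈ Ω) (f : X) : hX.evalCLM hz f = ι f z := rfl

/-- The weighted composition operators form a strongly continuous semigroup on `X`. -/
theorem IsAdmissible.exists_semigroup [CompleteSpace X] (hadm : IsAdmissible Ω φ g ι)
    (hX : IsHolomorphicFunctionSpace Ω ι) (hφ : IsHolomorphicSemiflow Ω φ) (hΩ : IsOpen Ω)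
    (hb : Bornology.IsBounded Ω) (hg : ContinuousOn g Ω) :
    ∃ S : ℝ → X →L[ℂ] X, IsC0Semigroup S ∧
      ∀ t, 0 ≤ t → ∀ f, EqOn (ι (S t f)) (weightedComp φ g t (ι f)) Ω := by
  obtain ⟨S, hS, hS0⟩ := hadm
  have hclm : ∀ t, 0 ≤ t → ∃ B : X →L[ℂ] X, ∀ f, B f = S t f := by
    intro t ht
    let L : X →ₗ[ℂ] X :=
      { toFun := S t
        map_add' := fun f f' => hX.injective _ _ fun z hz => by
          simp [hS t ht _ hz, weightedComp, mul_add]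
        map_smul' := fun c f => hX.injective _ _ fun z hz => by
          simp only [RingHom.id_apply, map_smul, Pi.smul_apply, hS t ht _ hz, weightedComp,
            smul_eq_mul]
          ring }
    -- Closed graph: evaluating the limits at `z` and at `φ_t z` identifies the limit of the images
    -- with the image of the limit.
    refine ⟨ContinuousLinearMap.ofSeqClosedGraph (g := L) fun u x y hu hy => ?_, fun f => rfl⟩
    refine hX.injective _ _ fun z hz => ?_
    have h1 := ((hX.continuous_eval z hz).tendsto y).comp hy
    have h2 := (((hX.continuous_eval _ (hφ.mapsTo t ht hz)).tendsto x).comp hu).const_mul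
      (cocycle φ g t z)
    refine tendsto_nhds_unique h1 ?_
    change Tendsto _ _ (𝓝 (ι (S t x) z))
    rw [hS t ht x hz]
    refine h2.congr fun n => ?_
    exact (hS t ht (u n) hz).symm
  choose! B hB using hclm
  have hB' : ∀ t, 0 ≤ t → ∀ f, EqOn (ι (B t f)) (weightedComp φ g t (ι f)) Ω := by
    intro t ht f
    rw [hB t ht]
    exact hS t ht f
  refine ⟨B, IsC0Semigroup.of_tendsto ?_ ?_ ?_, hB'⟩
  · ext f
    refine hX.injective _ _ fun z hz => ?_
    rw [hB' 0 le_rfl f hz, weightedComp_zero hφ _ hz]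
    rfl
  · intro s t hs ht
    ext f
    refine hX.injective _ _ fun z hz => ?_
    -- The summands are swapped so that the orbit is split at time `s`, matching the outer operator.
    rw [hB' _ (add_nonneg hs ht) f hz, add_comm s t, weightedComp_add hφ hΩ hb hg _ ht hs hz,
      ContinuousLinearMap.comp_apply, hB' s hs _ hz, weightedComp.eq_1 φ g s,
      hB' t ht _ (hφ.mapsTo s hs hz)]
  · intro f
    refine (hS0 f).congr' ?_
    filter_upwards [self_mem_nhdsWithin] with t ht using (hB t (le_of_lt ht) f).symm

/-- The generator of the weighted composition semigroup is `u ↦ g u + G u'` with maximal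
domain. -/
theorem generatorGraph_weightedComp_iff [CompleteSpace X]
    (hX : IsHolomorphicFunctionSpace Ω ι) (hφ : IsHolomorphicSemiflow Ω φ) (hΩ : IsOpen Ω)
    (hb : Bornology.IsBounded Ω) (hG : IsSemiflowGenerator Ω φ G) (hg : ContinuousOn g Ω)
    {S : ℝ → X →L[ℂ] X} (hS : IsC0Semigroup S)
    (hS' : ∀ t, 0 ≤ t → ∀ f, EqOn (ι (S t f)) (weightedComp φ g t (ι f)) Ω) {u f : X} :
    GeneratorGraph S u f ↔ ∀ z ∈ Ω, ι f z = g z * ι u z + G z * deriv (ι u) z := by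
  constructor
  · intro h z hz
    have h1 := ((hX.evalCLM hz).continuous.tendsto f).comp (generatorGraph_iff.1 h)
    have h2 := hasDerivWithinAt_Ioi_iff.1
      (hasDerivWithinAt_weightedComp_zero hφ hΩ hb hG hg (hX.holomorphic u) hz)
    refine tendsto_nhds_unique h1 (h2.congr' ?_)
    filter_upwards [self_mem_nhdsWithin] with t ht
    simp only [Function.comp_apply]
    rw [← Complex.coe_smul, ← Complex.coe_smul, map_smul, map_sub, hX.evalCLM_apply,
      hX.evalCLM_apply, hS' t (le_of_lt ht) u hz, zero_add, weightedComp_zero hφ _ hz]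
  · intro h
    refine hS.generatorGraph_of_integral fun t ht => hX.injective _ _ fun z hz => ?_
    rw [← hX.evalCLM_apply hz, ← (hX.evalCLM hz).intervalIntegral_comp_comm
      (intervalIntegrable_of_continuousOn_Ici (hS.continuousOn f) le_rfl ht),
      ← hX.evalCLM_apply hz, map_sub, hX.evalCLM_apply, hX.evalCLM_apply, hS' t ht u hz,
      ← integral_weightedComp hφ hΩ hb hG hg (hX.holomorphic u)
        (hX.holomorphic f).continuousOn h hz ht]
    refine intervalIntegral.integral_congr fun s hs => ?_
    rw [uIcc_of_le ht] at hs
    exact hS' s hs.1 f hz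

end Operators

/-! ### Transfer to the boundary space -/

section Boundary

/-- The real derivative is complex linear, so its value at `I` is `I u'`, and `(u' - I · I u') / 2 =
u'`. -/
theorem dz_eq_deriv {u : ℂ → ℂ} {z : ℂ} (hu : DifferentiableAt ℂ u z) : dz u z = deriv u z := by
  have h1 : fderiv ℝ u z = (fderiv ℂ u z).restrictScalars ℝ :=
    hu.fderiv_restrictScalars ℝ
  have h2 : fderiv ℂ u z Complex.I = Complex.I * deriv u z := by
    rw [← smul_eq_mul, ← fderiv_apply_one_eq_deriv, ← map_smul, smul_eq_mul, mul_one]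
  rw [dz, h1]
  simp only [ContinuousLinearMap.coe_restrictScalars', h2, fderiv_apply_one_eq_deriv]
  rw [← mul_assoc, Complex.I_mul_I]
  ring

theorem harmonicOnNhd_of_differentiableOn {u : ℂ → ℂ} {Ω : Set ℂ} (hΩ : IsOpen Ω)
    (hu : DifferentiableOn ℂ u Ω) : InnerProductSpace.HarmonicOnNhd u Ω :=
  fun _ hz => (hu.analyticAt (hΩ.mem_nhds hz)).harmonicAt

variable {Ω : Set ℂ} {k : ℂ → ℂ} {X : Type*} [NormedAddCommGroup X] [NormedSpace ℂ X]
  {ι : X →ₗ[ℂ] (ℂ → ℂ)}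

/-- The trace as an isometric isomorphism of `X` onto `∂X`. -/
noncomputable def traceIsometry (h : HasBoundarySpace Ω k ι) : X ≃ₗᵢ[ℂ] BoundarySpace h :=
  ⟨Tr h, norm_Tr h⟩

theorem completeSpace_boundarySpace [CompleteSpace X] (h : HasBoundarySpace Ω k ι) :
    CompleteSpace (BoundarySpace h) :=
  (traceIsometry h).toIsometryEquiv.completeSpace_iff.1 inferInstance

/-- The operator on `∂X` corresponding to an operator on `X`. -/
noncomputable def boundaryOperator (h : HasBoundarySpace Ω k ι) (B : X →L[ℂ] X) :
    BoundarySpace h →L[ℂ] BoundarySpace h :=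
  ((traceIsometry h : X →L[ℂ] BoundarySpace h).comp B).comp
    ((traceIsometry h).symm : BoundarySpace h →L[ℂ] X)

theorem boundaryOperator_Tr (h : HasBoundarySpace Ω k ι) (B : X →L[ℂ] X) (f : X) :
    boundaryOperator h B (Tr h f) = Tr h (B f) := by
  change traceIsometry h (B ((traceIsometry h).symm (traceIsometry h f))) = _
  rw [LinearIsometryEquiv.symm_apply_apply]
  rfl

theorem IsC0Semigroup.boundaryOperator {S : ℝ → X →L[ℂ] X} (hS : IsC0Semigroup S)
    (h : HasBoundarySpace Ω k ι) : IsC0Semigroup fun t => boundaryOperator h (S t) := by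
  refine ⟨?_, fun s t hs ht => ?_, fun y => ?_⟩
  · ext y
    obtain ⟨f, rfl⟩ := (Tr h).surjective y
    rw [boundaryOperator_Tr, hS.apply_zero]
    rfl
  · ext y
    obtain ⟨f, rfl⟩ := (Tr h).surjective y
    rw [ContinuousLinearMap.comp_apply, boundaryOperator_Tr, boundaryOperator_Tr,
      boundaryOperator_Tr, hS.apply_add hs ht]
  · obtain ⟨f, rfl⟩ := (Tr h).surjective y
    simp only [boundaryOperator_Tr]
    exact (traceIsometry h).continuous.comp_continuousOn (hS.continuousOn f)

theorem generatorGraph_boundaryOperator_iff (h : HasBoundarySpace Ω k ι) {S : ℝ → X →L[ℂ] X}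
    {u f : X} : GeneratorGraph (fun t => boundaryOperator h (S t)) (Tr h u) (Tr h f) ↔
      GeneratorGraph S u f := by
  rw [GeneratorGraph, GeneratorGraph,
    (traceIsometry h).toHomeomorph.isInducing.tendsto_nhds_iff]
  refine tendsto_congr fun t => ?_
  rw [boundaryOperator_Tr, ← map_sub, ← map_smul]
  rfl

/-- Injectivity of the trace determines the witnesses in the graph, and harmonicity is automatic for
holomorphic functions. -/
theorem dirichletToRobin_Tr_iff (h : HasBoundarySpace Ω k ι) (hΩ : IsOpen Ω)
    (hX : IsHolomorphicFunctionSpace Ω ι) {g G : ℂ → ℂ} {u f : X} :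
    DirichletToRobin h g G (Tr h u) (Tr h f) ↔
      ∀ z ∈ Ω, ι f z = g z * ι u z + G z * deriv (ι u) z := by
  constructor
  · rintro ⟨u', f', -, hu, huf, hf⟩ z hz
    rw [← (Tr h).injective hu, ← (Tr h).injective hf, huf z hz,
      dz_eq_deriv ((hX.holomorphic u').differentiableAt (hΩ.mem_nhds hz))]
  · intro huf
    refine ⟨u, f, harmonicOnNhd_of_differentiableOn hΩ (hX.holomorphic u), rfl,
      fun z hz => ?_, rfl⟩
    rw [huf z hz, dz_eq_deriv ((hX.holomorphic u).differentiableAt (hΩ.mem_nhds hz))]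

end Boundary

end DirichletRobin

/-! ### Well-posedness of the Dirichlet-to-Robin problem -/

theorem mainTheorem1 {Ω : Set ℂ} (hΩ : DirichletRobin.IsJordanDomain Ω)
    {φ : ℝ → ℂ → ℂ} (hφ : DirichletRobin.IsHolomorphicSemiflow Ω φ)
    {G : ℂ → ℂ} (hG : DirichletRobin.IsSemiflowGenerator Ω φ G)
    {g : ℂ → ℂ} (hg : DifferentiableOn ℂ g Ω)
    {k : ℂ → ℂ} (hk : DirichletRobin.IsConformalToDisc Ω k)
    {X : Type*} [NormedAddCommGroup X] [NormedSpace ℂ X] [CompleteSpace X]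
    {ι : X →ₗ[ℂ] (ℂ → ℂ)} (hX : DirichletRobin.IsHolomorphicFunctionSpace Ω ι)
    (hadm : DirichletRobin.IsAdmissible Ω φ g ι)
    (h : DirichletRobin.HasBoundarySpace Ω k ι) :
    DirichletRobin.IsWellPosed h g G ∧
    ∃ T : ℝ → DirichletRobin.BoundarySpace h →L[ℂ] DirichletRobin.BoundarySpace h,
      DirichletRobin.IsC0Semigroup T ∧
      (∀ t, 0 ≤ t → ∀ u : X, ∃ f : X,
        EqOn (DirichletRobin.weightedComp φ g t (ι u)) (ι f) Ω ∧
        T t (DirichletRobin.Tr h u) = DirichletRobin.Tr h f) ∧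
      (∀ v w, DirichletRobin.DirichletToRobin h g G v w ↔
        Tendsto (fun t : ℝ => ((t : ℂ)⁻¹) • (T t v - v)) (𝓝[>] 0) (𝓝 w)) ∧
      (∀ v₀ ∈ DirichletRobin.robinDomain h g G,
        DirichletRobin.IsClassicalSolution h g G v₀ fun t => T t v₀) ∧
      (∀ v₀ v, DirichletRobin.IsMildSolution h g G v₀ v ↔
        EqOn v (fun t => T t v₀) (Ici 0)) := by
  have := DirichletRobin.completeSpace_boundarySpace h
  obtain ⟨S, hS, hS'⟩ := hadm.exists_semigroup hX hφ hΩ.isOpen hΩ.isBounded hg.continuousOn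
  have hT := hS.boundaryOperator h
  -- Equality of the graphs, domains included, turns every remaining claim into a statement about
  -- the semigroup and its generator.
  have hgen : ∀ v w, DirichletRobin.DirichletToRobin h g G v w ↔
      DirichletRobin.GeneratorGraph (fun t => DirichletRobin.boundaryOperator h (S t)) v w := by
    intro v w
    obtain ⟨u, rfl⟩ := (DirichletRobin.Tr h).surjective v
    obtain ⟨f, rfl⟩ := (DirichletRobin.Tr h).surjective w
    rw [DirichletRobin.generatorGraph_boundaryOperator_iff,
      DirichletRobin.dirichletToRobin_Tr_iff h hΩ.isOpen hX,
      DirichletRobin.generatorGraph_weightedComp_iff hX hφ hΩ.isOpen hΩ.isBounded hG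
        hg.continuousOn hS hS']
  have hsol : ∀ v₀ v, DirichletRobin.IsSolution h g G v₀ v →
      ∀ t, 0 ≤ t → v t = DirichletRobin.boundaryOperator h (S t) v₀ := by
    intro v₀ v hv t ht
    rw [← hv.initial]
    refine hT.eq_of_hasDerivAt hv.continuousOn (fun t ht => ?_) ht
    obtain ⟨w, hw, hw'⟩ := hv.equation t ht
    exact ⟨w, (hgen _ _).1 hw, hw'⟩
  have hclass : ∀ v₀ ∈ DirichletRobin.robinDomain h g G,
      DirichletRobin.IsClassicalSolution h g G v₀ fun t =>
        DirichletRobin.boundaryOperator h (S t) v₀ := by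
    rintro v₀ ⟨w, hw⟩
    have hw' := (hgen _ _).1 hw
    have hderiv := fun t (ht : 0 ≤ t) => hT.hasDerivWithinAt hw' ht
    have hgraph := fun t (ht : 0 ≤ t) => (hgen _ _).2 (hT.generatorGraph_apply hw' ht)
    exact
      { continuousOn := hT.continuousOn v₀
        initial := hT.apply_zero v₀
        equation := fun t ht => ⟨_, hgraph t ht.le, (hderiv t ht.le).hasDerivAt (Ici_mem_nhds ht)⟩
        continuously_differentiable :=
          ⟨_, hT.continuousOn w, fun t ht => ⟨hgraph t ht, hderiv t ht⟩⟩ }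
  refine ⟨⟨?_, fun v₀ hv₀ => ⟨_, hclass v₀ hv₀⟩, ?_, ?_⟩, _, hT, ?_, hgen, hclass, ?_⟩
  · simpa only [DirichletRobin.robinDomain, hgen] using hT.dense_generator_domain
  · intro v₀ v v' hv hv' t ht
    rw [hsol v₀ v hv t ht, hsol v₀ v' hv' t ht]
  · intro τ _
    obtain ⟨C, -, hC⟩ := hT.exists_norm_le τ
    refine ⟨C, fun v₀ v hv t ht => ?_⟩
    rw [hsol v₀ v hv t ht.1]
    exact ContinuousLinearMap.le_of_opNorm_le _ (hC t ht) _
  · exact fun t ht u => ⟨S t u, (hS' t ht u).symm, DirichletRobin.boundaryOperator_Tr h (S t) u⟩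
  · intro v₀ v
    rw [← hT.mild_iff]
    simp only [← hgen]
    exact ⟨fun hv => ⟨hv.continuousOn, hv.equation⟩, fun hv => ⟨hv.1, hv.2⟩⟩
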